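/- Let $\Theta$ be a finite set of states with $|\Theta| = n \ge 2$, and let $\Delta$ be the simplex of probability vectors (beliefs) on $\Theta$. A decision problem consists of a nonempty set $A$ of actions and a bounded utility function $u : A \times \Theta \to \mathbb{R}$. Call $a \in A$ undominated if there is $x \in \Delta$ with $\mathbb{E}_x u(a,\theta) > \mathbb{E}_x u(b,\theta)$ for all $b \in A \setminus \{a\}$. It is assumed throughout that only finitely many actions are undominated and that at each belief the maximum over $A$ of expected utility is attained by an undominated action. Let $V(x) = \max_{a \in A} \mathbb{E}_x u(a,\theta)$, and for each undominated action $a_i$ ($i = 1, \dots, t$) let $C_i = \{x \in \Delta : \mathbb{E}_x u(a_i,\theta) = V(x)\}$. For a full-support prior $\mu$ and a nonnegative matrix $(\pi(s \mid \theta))_{\theta \in \Theta, s \in S}$ with $S$ finite, let $p_s = \sum_{\theta} \mu(\theta)\pi(s \mid \theta)$ and, when $p_s > 0$, let $x_s(\theta) = \mu(\theta)\pi(s \mid \theta)/p_s$ be the posterior after $s$. The matrix is sub-stochastic if its rows sum to at most $1$, and an experiment if they sum to exactly $1$. The spectral subdivision induced by the decision problem at the prior $\mu$ is $\tilde{C}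 = \{\tilde{C}_1, \dots, \tilde{C}_t\}$, where $\tilde{C}_i$ is the family of all sub-stochastic matrices (with any finite set of columns $S$) such that $p_s > 0$ for all $s \in S$ and $\{x_s : s \in S\}$ is exactly the set of extreme points of $C_i$. A spectral subdivision is any $\tilde{C}$ that is induced by some decision problem at some full-support prior. The value of an experiment $\pi$ is $W(\pi) = \sum_{s : p_s > 0} p_s V(x_s)$. A collection of ranked experiments consists of finitely many experiments $\pi_1, \dots, \pi_m$ and rankings between some of them, of the form $\pi_i \succ \pi_j$ and $\pi_k \sim \pi_l$. A decision problem and a prior satisfy it if $W(\pi_i) > W(\pi_j)$ and $W(\pi_k) = W(\pi_l)$ for all of these rankings. The collection identifies $\tilde{C}$ if (i) for every full-support prior $\mu$ there is a decision problem that, at $\mu$, satisfies the collection and induces $\tilde{C}$; and (ii) every decision problem and full-support prior that satisfy the collection induce $\tilde{C}$. Then for every spectral subdivision $\tilde{C}$ there exists a collection of ranked experiments that identifies it. -/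

import Mathlib

/-! Decision problems, Blackwell experiments and spectral subdivisions over a finite set `Θ` of
states. A belief is a point of `stdSimplex ℝ Θ`. -/

universe u v

noncomputable section

/-- Expected utility `𝔼ₓ u(a, θ)` of an action with payoff vector `p = u(a, ·)` in the belief `x`. -/
def expUtil {Θ : Type u} [Fintype Θ] (x : Θ → ℝ) (p : Θ → ℝ) : ℝ := ∑ θ, x θ * p θ

/-- An action is undominated if it is the unique optimal action in some belief. -/
def IsUndominated {Θ : Type u} [Fintype Θ] {A : Type v} (util : A → Θ → ℝ) (a : A) : Prop :=
  ∃ x ∈ stdSimplex ℝ Θ, ∀ b, b ≠ a → expUtil x (util b) < expUtil x (util a)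

/-- A decision problem with state space `Θ`: a nonempty (possibly infinite) set of actions and a
bounded utility function, such that only finitely many actions are undominated and these are the
relevant ones, i.e. in each belief the maximal expected utility is attained, and attained by an
undominated action. (Two undominated actions cannot have the same payoffs in every state, by the
definition of `IsUndominated`.) -/
structure DecisionProblem (Θ : Type u) [Fintype Θ] where
  /-- the set of actions -/
  Action : Type v
  /-- the utility function -/
  util : Action → Θ → ℝ
  nonempty : Nonempty Action
  bounded : ∃ M : ℝ, ∀ a θ, |util a θ| ≤ M
  finite_undominated : {a | IsUndominated util a}.Finite
  exists_optimal : ∀ x ∈ stdSimplex ℝ Θ, ∃ a, IsUndominated util a ∧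
    ∀ b, expUtil x (util b) ≤ expUtil x (util a)

/-- The value function `V(x) = max_a 𝔼ₓ u(a, θ)`. -/
def DecisionProblem.value {Θ : Type u} [Fintype Θ] (D : DecisionProblem.{u, v} Θ)
    (x : Θ → ℝ) : ℝ :=
  ⨆ a : D.Action, expUtil x (D.util a)

/-- The set of beliefs in which the action `a` is optimal. -/
def DecisionProblem.cell {Θ : Type u} [Fintype Θ] (D : DecisionProblem.{u, v} Θ)
    (a : D.Action) : Set (Θ → ℝ) :=
  {x | x ∈ stdSimplex ℝ Θ ∧ expUtil x (D.util a) = D.value x}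

/-- Full-support priors. -/
def IsFullSupportPrior {Θ : Type u} [Fintype Θ] (μ : Θ → ℝ) : Prop :=
  μ ∈ stdSimplex ℝ Θ ∧ ∀ θ, 0 < μ θ

/-- A matrix whose rows are indexed by the states and which has finitely many columns, one for
each signal realization. -/
structure SignalMatrix (Θ : Type u) where
  /-- the number of signal realizations -/
  size : ℕ
  /-- `entry θ s` is the probability of the realization `s` in state `θ` -/
  entry : Θ → Fin size → ℝ

/-- The rows are sub-probability measures. -/
def SignalMatrix.IsSubstochastic {Θ : Type u} (P : SignalMatrix Θ) : Prop :=
  (∀ θ s, 0 ≤ P.entry θ s) ∧ ∀ θ, ∑ s, P.entry θ s ≤ 1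

/-- The rows are probability measures, i.e. the matrix is a Blackwell experiment. -/
def SignalMatrix.IsExperiment {Θ : Type u} (P : SignalMatrix Θ) : Prop :=
  (∀ θ s, 0 ≤ P.entry θ s) ∧ ∀ θ, ∑ s, P.entry θ s = 1

/-- The ex-ante probability of the realization `s` under the prior `μ`. -/
def SignalMatrix.prob {Θ : Type u} [Fintype Θ] (P : SignalMatrix Θ) (μ : Θ → ℝ)
    (s : Fin P.size) : ℝ :=
  ∑ θ, μ θ * P.entry θ s

/-- The posterior after the realization `s`, by Bayes' law (meaningful if `s` has positive
probability). -/
def SignalMatrix.posterior {Θ : Type u} [Fintype Θ] (P : SignalMatrix Θ) (μ : Θ → ℝ)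
    (s : Fin P.size) : Θ → ℝ :=
  fun θ => μ θ * P.entry θ s / P.prob μ s

/-- The family of substochastic matrices whose posteriors under the prior `μ` are precisely the
extreme points of the set `K` of beliefs; each realization has to have a well-defined
posterior. -/
def spectralElement {Θ : Type u} [Fintype Θ] (μ : Θ → ℝ) (K : Set (Θ → ℝ)) :
    Set (SignalMatrix Θ) :=
  {P | P.IsSubstochastic ∧ (∀ s, 0 < P.prob μ s) ∧
    (∀ s, P.posterior μ s ∈ Set.extremePoints ℝ K) ∧
    (⋃ s, {P.posterior μ s}) = Set.extremePoints ℝ K}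

/-- The spectral subdivision that a decision problem induces under the prior `μ`: its elements
are the spectral elements of the cells of the undominated actions. -/
def DecisionProblem.spectralSubdivision {Θ : Type u} [Fintype Θ] (D : DecisionProblem.{u, v} Θ)
    (μ : Θ → ℝ) : Set (Set (SignalMatrix Θ)) :=
  {E | ∃ a, IsUndominated D.util a ∧ E = spectralElement μ (D.cell a)}

/-- Spectral subdivisions: those induced by some decision problem under some full-support
prior. -/
def IsSpectralSubdivision {Θ : Type u} [Fintype Θ] (C : Set (Set (SignalMatrix Θ))) : Prop :=
  ∃ (D : DecisionProblem.{u, v} Θ) (μ : Θ → ℝ),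
    IsFullSupportPrior μ ∧ D.spectralSubdivision μ = C

/-- The value `W(π)` of observing the experiment `P` under the prior `μ` before acting: the
expectation of `V` at the random posterior. -/
def DecisionProblem.experimentValue {Θ : Type u} [Fintype Θ] (D : DecisionProblem.{u, v} Θ)
    (μ : Θ → ℝ) (P : SignalMatrix Θ) : ℝ :=
  ∑ s, P.prob μ s * D.value (P.posterior μ s)

/-- A collection of ranked experiments: finitely many experiments, with rankings of the form
`πᵢ ≻ πⱼ` and `πₖ ∼ πₗ` between some of them. -/
structure RankedExperiments (Θ : Type u) where
  /-- the number of experiments -/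
  num : ℕ
  /-- the experiments -/
  expt : Fin num → SignalMatrix Θ
  isExperiment : ∀ i, (expt i).IsExperiment
  /-- the pairs `(i, j)` ranked `πᵢ ≻ πⱼ` -/
  strict : Set (Fin num × Fin num)
  /-- the pairs `(k, l)` ranked `πₖ ∼ πₗ` -/
  indiff : Set (Fin num × Fin num)

/-- A decision problem and a prior satisfy a collection of ranked experiments. -/
def RankedExperiments.SatisfiedBy {Θ : Type u} [Fintype Θ] (R : RankedExperiments Θ)
    (D : DecisionProblem.{u, v} Θ) (μ : Θ → ℝ) : Prop :=
  (∀ i j, (i, j) ∈ R.strict →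
    D.experimentValue μ (R.expt j) < D.experimentValue μ (R.expt i)) ∧
  (∀ k l, (k, l) ∈ R.indiff →
    D.experimentValue μ (R.expt k) = D.experimentValue μ (R.expt l))

/-- A collection of ranked experiments identifies `C` if for each full-support prior some decision
problem satisfies the collection and induces `C`, and each decision problem and full-support prior
that satisfy the collection induce `C`. -/
def RankedExperiments.Identifies {Θ : Type u} [Fintype Θ] (R : RankedExperiments Θ)
    (C : Set (Set (SignalMatrix Θ))) : Prop :=
  (∀ μ : Θ → ℝ, IsFullSupportPrior μ →
    ∃ D : DecisionProblem.{u, v} Θ, R.SatisfiedBy D μ ∧ D.spectralSubdivision μ = C) ∧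
  (∀ (D : DecisionProblem.{u, v} Θ) (μ : Θ → ℝ), IsFullSupportPrior μ →
    R.SatisfiedBy D μ → D.spectralSubdivision μ = C)

end

/-! Extend `V` to nonnegative vectors as a positively homogeneous function. Then `W(π)` is the sum
of `V(μ · π(s | ·))` over the columns, so prior and payoffs matter only through the products `μ θ *
u(a, θ)`. Multiplying payoffs by `ν` at the prior `μ` has the same effect as replacing `μ` by `ν *
μ`, for values and also for spectral subdivisions, since Bayesian reweighting is a projective
bijection of the simplex and preserves extreme points. It therefore suffices to work with the weight
vector `1` (`experimentValue_scale`, `spectralSubdivision_scale`).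

There `V` is subadditive, and pooling a finite set `X` of posteriors costs nothing exactly when one
cell contains `X` (`value_sum_eq_iff`). Cells are polytopes with finitely many vertices. Taking for
`X` the vertices of one cell, an indifference says that this cell lies in a cell of the competing
problem; taking the vertices of two distinct cells, a strict ranking says that no competing cell
contains both. Since the original cells cover the simplex, this injective refinement forces equality
of all cells (`spectralSubdivision_eq_of_commonCell`). -/

open Set Filter Topology

/-! ### Finiteness of the vertex set of a polyhedron. -/

section Polytope

variable {E ι : Type*} [AddCommGroup E] [Module ℝ E]

/-- The set cut out by finitely many linear inequalities inside a level set of a linear functional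
has finitely many extreme points, since an extreme point is determined by its active
constraints. -/
theorem finite_extremePoints_of_linear_inequalities [Finite ι] (f : E →ₗ[ℝ] ℝ) (m : ℝ)
    (g : ι → E →ₗ[ℝ] ℝ) :
    (extremePoints ℝ {x | f x = m ∧ ∀ i, 0 ≤ g i x}).Finite := by
  refine Set.Finite.of_finite_image (f := fun x => {i | g i x = 0}) (Set.toFinite _) ?_
  intro x hx y hy hxy
  have hact : ∀ i, g i x = 0 → g i y = 0 := fun i hi => by
    have : i ∈ {i | g i x = 0} := hi
    simp only at hxy
    rw [hxy] at this
    exact this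
  obtain ⟨⟨hx1, hx2⟩, hx3⟩ := hx
  obtain ⟨⟨hy1, hy2⟩, -⟩ := hy
  -- The segment from `y` can be prolonged slightly past `x`: constraints active at `x` are active
  -- at `y` too and stay active, while slack ones survive a small step. Hence an extreme `x` must
  -- equal `y`.
  have hev : ∀ᶠ ε : ℝ in 𝓝[>] 0, ∀ i, 0 ≤ g i x + ε * (g i x - g i y) := by
    rw [eventually_all]
    intro i
    rcases (hx2 i).eq_or_lt with h | h
    · refine Eventually.of_forall fun ε => ?_
      simp [← h, hact i h.symm]
    · have hc : Tendsto (fun ε : ℝ => g i x + ε * (g i x - g i y)) (𝓝[>] 0)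
          (𝓝 (g i x + 0 * (g i x - g i y))) :=
        (Continuous.tendsto (by fun_prop) 0).mono_left nhdsWithin_le_nhds
      rw [zero_mul, add_zero] at hc
      exact (hc.eventually (lt_mem_nhds h)).mono fun _ => le_of_lt
  obtain ⟨ε, hε, hε0⟩ := (hev.and self_mem_nhdsWithin).exists
  have hε0 : 0 < ε := hε0
  have hmem : x + ε • (x - y) ∈ {x | f x = m ∧ ∀ i, 0 ≤ g i x} := by
    refine ⟨by simp [hx1, hy1], fun i => ?_⟩
    simpa using hε i
  have hseg : x ∈ openSegment ℝ y (x + ε • (x - y)) := by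
    refine ⟨ε / (1 + ε), 1 / (1 + ε), by positivity, by positivity, by field_simp; ring, ?_⟩
    have h1 : (ε / (1 + ε)) = (1 / (1 + ε)) * ε := by ring
    have h2 : (1 / (1 + ε)) * (1 + ε) = 1 := by field_simp
    calc (ε / (1 + ε)) • y + (1 / (1 + ε)) • (x + ε • (x - y))
        = ((1 / (1 + ε)) * (1 + ε)) • x := by rw [h1]; module
      _ = x := by rw [h2, one_smul]
  exact (hx3 ⟨hy1, hy2⟩ hmem hseg).symm

end Polytope

/-! ### Bayesian reweighting of beliefs. -/

section ExpectedUtility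

variable {Θ : Type u} [Fintype Θ]

/-- Expected utility as a linear functional of the belief. -/
noncomputable def expUtilLinear (p : Θ → ℝ) : (Θ → ℝ) →ₗ[ℝ] ℝ where
  toFun x := expUtil x p
  map_add' x y := by simp [expUtil, add_mul, Finset.sum_add_distrib]
  map_smul' c x := by simp [expUtil, Finset.mul_sum, mul_assoc]

theorem expUtil_add (x y p : Θ → ℝ) : expUtil (x + y) p = expUtil x p + expUtil y p :=
  (expUtilLinear p).map_add x y

theorem expUtil_smul (c : ℝ) (x p : Θ → ℝ) : expUtil (c • x) p = c * expUtil x p :=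
  (expUtilLinear p).map_smul c x

theorem expUtil_sum {ι : Type*} (s : Finset ι) (f : ι → Θ → ℝ) (p : Θ → ℝ) :
    expUtil (∑ i ∈ s, f i) p = ∑ i ∈ s, expUtil (f i) p :=
  map_sum (expUtilLinear p) f s

theorem expUtil_mul_right (x ν p : Θ → ℝ) : expUtil x (ν * p) = expUtil (ν * x) p := by
  simp only [expUtil, Pi.mul_apply]
  exact Finset.sum_congr rfl fun θ _ => by ring

@[fun_prop]
theorem continuous_expUtil (p : Θ → ℝ) : Continuous fun x => expUtil x p := by
  unfold expUtil
  fun_prop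

/-- The belief proportional to a nonnegative vector. -/
noncomputable def toBelief (y : Θ → ℝ) : Θ → ℝ := (∑ θ, y θ)⁻¹ • y

theorem toBelief_mem_stdSimplex {y : Θ → ℝ} (hy : ∀ θ, 0 ≤ y θ) (hs : 0 < ∑ θ, y θ) :
    toBelief y ∈ stdSimplex ℝ Θ := by
  refine ⟨fun θ => mul_nonneg (inv_nonneg.2 hs.le) (hy θ), ?_⟩
  simp only [toBelief, Pi.smul_apply, smul_eq_mul, ← Finset.mul_sum]
  exact inv_mul_cancel₀ hs.ne'

theorem sum_mul_pos {ν x : Θ → ℝ} (hν : ∀ θ, 0 < ν θ) (hx : ∀ θ, 0 ≤ x θ)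
    (hs : 0 < ∑ θ, x θ) : 0 < ∑ θ, (ν * x) θ := by
  obtain ⟨θ, -, hθ⟩ := (Finset.sum_pos_iff_of_nonneg fun θ _ => hx θ).1 hs
  exact Finset.sum_pos' (fun θ _ => mul_nonneg (hν θ).le (hx θ))
    ⟨θ, Finset.mem_univ θ, mul_pos (hν θ) hθ⟩

theorem sum_mul_pos_of_mem {ν x : Θ → ℝ} (hν : ∀ θ, 0 < ν θ) (hx : x ∈ stdSimplex ℝ Θ) :
    0 < ∑ θ, (ν * x) θ :=
  sum_mul_pos hν hx.1 (by rw [hx.2]; exact one_pos)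

theorem toBelief_mul_mem {ν x : Θ → ℝ} (hν : ∀ θ, 0 < ν θ) (hx : x ∈ stdSimplex ℝ Θ) :
    toBelief (ν * x) ∈ stdSimplex ℝ Θ :=
  toBelief_mem_stdSimplex (fun θ => mul_nonneg (hν θ).le (hx.1 θ)) (sum_mul_pos_of_mem hν hx)

theorem toBelief_smul {c : ℝ} (hc : 0 < c) (y : Θ → ℝ) : toBelief (c • y) = toBelief y := by
  simp only [toBelief, Pi.smul_apply, smul_eq_mul, ← Finset.mul_sum, mul_inv, smul_smul]
  congr 1
  field_simp

theorem toBelief_of_mem {x : Θ → ℝ} (hx : x ∈ stdSimplex ℝ Θ) : toBelief x = x := by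
  simp [toBelief, hx.2]

/-- Reweighting and normalizing twice is reweighting with the product. -/
theorem toBelief_mul_toBelief {ν y : Θ → ℝ} (ρ : Θ → ℝ) (hs : 0 < ∑ θ, (ν * y) θ) :
    toBelief (ρ * toBelief (ν * y)) = toBelief (ρ * ν * y) := by
  rw [toBelief, toBelief, mul_smul_comm, ← toBelief, toBelief_smul (inv_pos.2 hs), mul_assoc]

theorem toBelief_inv_mul_toBelief {ν x : Θ → ℝ} (hν : ∀ θ, 0 < ν θ)
    (hx : x ∈ stdSimplex ℝ Θ) : toBelief (ν⁻¹ * toBelief (ν * x)) = x := by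
  have h : ν⁻¹ * ν = 1 := by
    ext θ
    simp [(hν θ).ne']
  rw [toBelief_mul_toBelief _ (sum_mul_pos_of_mem hν hx), h, one_mul, toBelief_of_mem hx]

theorem toBelief_mul_toBelief_inv {ν x : Θ → ℝ} (hν : ∀ θ, 0 < ν θ)
    (hx : x ∈ stdSimplex ℝ Θ) : toBelief (ν * toBelief (ν⁻¹ * x)) = x := by
  have := toBelief_inv_mul_toBelief (ν := ν⁻¹) (fun θ => inv_pos.2 (hν θ)) hx
  rwa [inv_inv] at this

theorem expUtil_lt_toBelief_iff {y : Θ → ℝ} (hs : 0 < ∑ θ, y θ) (p q : Θ → ℝ) :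
    expUtil (toBelief y) p < expUtil (toBelief y) q ↔ expUtil y p < expUtil y q := by
  rw [toBelief, expUtil_smul, expUtil_smul]
  exact mul_lt_mul_iff_right₀ (inv_pos.2 hs)

theorem expUtil_le_toBelief_iff {y : Θ → ℝ} (hs : 0 < ∑ θ, y θ) (p q : Θ → ℝ) :
    expUtil (toBelief y) p ≤ expUtil (toBelief y) q ↔ expUtil y p ≤ expUtil y q := by
  rw [toBelief, expUtil_smul, expUtil_smul]
  exact mul_le_mul_iff_right₀ (inv_pos.2 hs)

/-- Bayesian reweighting by `ν` as a map on sets of beliefs preserves extreme points. -/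
theorem toBelief_mul_mem_extremePoints {ν : Θ → ℝ} (hν : ∀ θ, 0 < ν θ) {K L : Set (Θ → ℝ)}
    (hK : K ⊆ stdSimplex ℝ Θ) (hL : L ⊆ stdSimplex ℝ Θ)
    (hKL : ∀ x ∈ stdSimplex ℝ Θ, toBelief (ν * x) ∈ L ↔ x ∈ K) {x : Θ → ℝ}
    (hx : x ∈ extremePoints ℝ K) : toBelief (ν * x) ∈ extremePoints ℝ L := by
  have hxK := hx.1
  refine ⟨(hKL x (hK hxK)).2 hxK, ?_⟩
  have key : ∀ y ∈ L, ∃ z ∈ K, y = toBelief (ν * z) := fun y hy => by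
    have hν' : ∀ θ, 0 < ν⁻¹ θ := fun θ => inv_pos.2 (hν θ)
    have hz := toBelief_mul_mem hν' (hL hy)
    have he := toBelief_mul_toBelief_inv hν (hL hy)
    refine ⟨_, (hKL _ hz).1 ?_, he.symm⟩
    rwa [he]
  intro y₁ hy₁ y₂ hy₂ hseg
  obtain ⟨z₁, hz₁, rfl⟩ := key y₁ hy₁
  obtain ⟨z₂, hz₂, rfl⟩ := key y₂ hy₂
  obtain ⟨s, t, hs, ht, -, hst⟩ := hseg
  have h0 := sum_mul_pos_of_mem hν (hK hxK)
  have h1 := sum_mul_pos_of_mem hν (hK hz₁)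
  have h2 := sum_mul_pos_of_mem hν (hK hz₂)
  simp only [toBelief] at hst
  set c := ∑ θ, (ν * x) θ
  set c₁ := ∑ θ, (ν * z₁) θ
  set c₂ := ∑ θ, (ν * z₂) θ
  -- Cancelling `ν` turns the convex combination of images into a combination of preimages whose
  -- coefficients absorb the normalizers. They sum to one because `x`, `z₁` and `z₂` all have total
  -- mass one.
  have hx_eq : (c * s * c₁⁻¹) • z₁ + (c * t * c₂⁻¹) • z₂ = x := by
    ext θ
    have hθ := congrFun hst θ
    simp only [Pi.add_apply, Pi.smul_apply, Pi.mul_apply, smul_eq_mul] at hθ ⊢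
    have hνθ := (hν θ).ne'
    have hc := h0.ne'
    calc c * s * c₁⁻¹ * z₁ θ + c * t * c₂⁻¹ * z₂ θ
        = c * (ν θ)⁻¹ * (ν θ) * (s * c₁⁻¹ * z₁ θ + t * c₂⁻¹ * z₂ θ) := by
          rw [mul_assoc c _ (ν θ), inv_mul_cancel₀ hνθ]; ring
      _ = c * (ν θ)⁻¹ * (s * (c₁⁻¹ * (ν θ * z₁ θ)) + t * (c₂⁻¹ * (ν θ * z₂ θ))) := by ring
      _ = x θ := by rw [hθ]; field_simp
  have hsum : c * s * c₁⁻¹ + c * t * c₂⁻¹ = 1 := by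
    have := congrArg (fun y : Θ → ℝ => ∑ θ, y θ) hx_eq
    simpa [Finset.sum_add_distrib, ← Finset.mul_sum, (hK hxK).2, (hK hz₁).2, (hK hz₂).2]
      using this
  have := hx.2 hz₁ hz₂ ⟨_, _, by positivity, by positivity, hsum, hx_eq⟩
  rw [this]

end ExpectedUtility

/-! ### Trading prior weights against payoffs. -/

section Scale

variable {Θ : Type u} [Fintype Θ]

theorem isUndominated_mul_iff {A : Type v} {ν : Θ → ℝ} (hν : ∀ θ, 0 < ν θ) (w : A → Θ → ℝ)
    (a : A) : IsUndominated (fun a => ν * w a) a ↔ IsUndominated w a := by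
  constructor
  · rintro ⟨x, hx, h⟩
    refine ⟨_, toBelief_mul_mem hν hx, fun b hb => ?_⟩
    rw [expUtil_lt_toBelief_iff (sum_mul_pos_of_mem hν hx)]
    simpa only [expUtil_mul_right] using h b hb
  · rintro ⟨x, hx, h⟩
    have hν' : ∀ θ, 0 < ν⁻¹ θ := fun θ => inv_pos.2 (hν θ)
    refine ⟨_, toBelief_mul_mem hν' hx, fun b hb => ?_⟩
    have h1 : ν * (ν⁻¹ * x) = x := by
      ext θ
      simp [(hν θ).ne']
    rw [expUtil_lt_toBelief_iff (sum_mul_pos_of_mem hν' hx)]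
    simpa only [expUtil_mul_right, h1] using h b hb

/-- The decision problem in which payoffs in state `θ` are multiplied by `ν θ`. -/
noncomputable def DecisionProblem.scale (D : DecisionProblem.{u, v} Θ) (ν : Θ → ℝ) (hν : ∀ θ, 0 < ν θ) :
    DecisionProblem.{u, v} Θ where
  Action := D.Action
  util a := ν * D.util a
  nonempty := D.nonempty
  bounded := by
    obtain ⟨M, hM⟩ := D.bounded
    refine ⟨(∑ θ, ν θ) * M, fun a θ => ?_⟩
    rw [Pi.mul_apply, abs_mul, abs_of_pos (hν θ)]
    exact mul_le_mul (Finset.single_le_sum (fun θ _ => (hν θ).le) (Finset.mem_univ θ)) (hM a θ)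
      (abs_nonneg _) (Finset.sum_nonneg fun θ _ => (hν θ).le)
  finite_undominated := by
    simpa only [isUndominated_mul_iff hν] using D.finite_undominated
  exists_optimal x hx := by
    obtain ⟨a, ha, h⟩ := D.exists_optimal _ (toBelief_mul_mem hν hx)
    refine ⟨a, (isUndominated_mul_iff hν _ a).2 ha, fun b => ?_⟩
    have := h b
    rw [expUtil_le_toBelief_iff (sum_mul_pos_of_mem hν hx)] at this
    simpa only [expUtil_mul_right] using this

theorem DecisionProblem.value_smul (D : DecisionProblem.{u, v} Θ) {c : ℝ} (hc : 0 ≤ c)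
    (y : Θ → ℝ) : D.value (c • y) = c * D.value y := by
  simp only [DecisionProblem.value, expUtil_smul, Real.mul_iSup_of_nonneg hc]

theorem DecisionProblem.value_scale (D : DecisionProblem.{u, v} Θ) (ν : Θ → ℝ)
    (hν : ∀ θ, 0 < ν θ) (y : Θ → ℝ) : (D.scale ν hν).value y = D.value (ν * y) := by
  simp only [DecisionProblem.value, DecisionProblem.scale, expUtil_mul_right]

theorem SignalMatrix.posterior_eq (P : SignalMatrix Θ) (μ : Θ → ℝ) (s : Fin P.size) :
    P.posterior μ s = toBelief (μ * fun θ => P.entry θ s) := by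
  ext θ
  simp [SignalMatrix.posterior, SignalMatrix.prob, toBelief, div_eq_inv_mul]

/-- The value of an experiment as a sum over its columns of a function that depends on the prior
only through the prior-weighted payoffs. -/
theorem DecisionProblem.experimentValue_eq (D : DecisionProblem.{u, v} Θ) {μ : Θ → ℝ}
    (hμ : ∀ θ, 0 < μ θ) {P : SignalMatrix Θ} (hP : P.IsExperiment) :
    D.experimentValue μ P = ∑ s, D.value (μ * fun θ => P.entry θ s) := by
  refine Finset.sum_congr rfl fun s _ => ?_
  have hnn : ∀ θ, 0 ≤ (μ * fun θ => P.entry θ s) θ := fun θ =>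
    mul_nonneg (hμ θ).le (hP.1 θ s)
  have hp : 0 ≤ P.prob μ s := Finset.sum_nonneg fun θ _ => hnn θ
  rw [← D.value_smul hp, P.posterior_eq]
  congr 1
  -- A realization of probability zero has a meaningless posterior, but its weighted column
  -- vanishes, so both sides are the zero vector.
  rcases hp.eq_or_lt with h | h
  · have h0 := (Finset.sum_eq_zero_iff_of_nonneg fun θ _ => hnn θ).1 h.symm
    rw [← h, zero_smul]
    ext θ
    exact (h0 θ (Finset.mem_univ θ)).symm
  · rw [toBelief, smul_smul]
    exact (by rw [show P.prob μ s * (∑ θ, (μ * fun θ => P.entry θ s) θ)⁻¹ = 1 from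
      mul_inv_cancel₀ h.ne', one_smul])

theorem DecisionProblem.experimentValue_scale (D : DecisionProblem.{u, v} Θ) {ν μ : Θ → ℝ}
    (hν : ∀ θ, 0 < ν θ) (hμ : ∀ θ, 0 < μ θ) {P : SignalMatrix Θ} (hP : P.IsExperiment) :
    (D.scale ν hν).experimentValue μ P = D.experimentValue (ν * μ) P := by
  rw [experimentValue_eq _ hμ hP, experimentValue_eq (μ := ν * μ) _ (fun θ => mul_pos (hν θ) (hμ θ)) hP]
  simp only [value_scale, mul_assoc]

/-- Posteriors under `ν * μ` are the reweightings by `ν` of the posteriors under `μ`, and this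
reweighting matches the extreme points of `K` with those of `L`. -/
theorem spectralElement_congr {ν μ : Θ → ℝ} (hν : ∀ θ, 0 < ν θ) (hμ : ∀ θ, 0 < μ θ)
    {K L : Set (Θ → ℝ)} (hK : K ⊆ stdSimplex ℝ Θ) (hL : L ⊆ stdSimplex ℝ Θ)
    (hKL : ∀ x ∈ stdSimplex ℝ Θ, toBelief (ν * x) ∈ L ↔ x ∈ K) :
    spectralElement μ K = spectralElement (ν * μ) L := by
  have hν' : ∀ θ, 0 < ν⁻¹ θ := fun θ => inv_pos.2 (hν θ)
  have hext : ∀ x ∈ stdSimplex ℝ Θ,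
      toBelief (ν * x) ∈ extremePoints ℝ L ↔ x ∈ extremePoints ℝ K := fun x hx => by
    refine ⟨fun h => ?_, toBelief_mul_mem_extremePoints hν hK hL hKL⟩
    have := toBelief_mul_mem_extremePoints hν' hL hK (fun y hy => by
      rw [← hKL _ (toBelief_mul_mem hν' hy), toBelief_mul_toBelief_inv hν hy]) h
    rwa [toBelief_inv_mul_toBelief hν hx] at this
  ext P
  refine and_congr_right fun hP => ?_
  have hnn : ∀ s θ, 0 ≤ (μ * fun θ => P.entry θ s) θ := fun s θ =>
    mul_nonneg (hμ θ).le (hP.1 θ s)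
  have hprob : ∀ s, 0 < P.prob (ν * μ) s ↔ 0 < P.prob μ s := fun s => by
    have h1 : P.prob (ν * μ) s = ∑ θ, (ν * (μ * fun θ => P.entry θ s)) θ :=
      Finset.sum_congr rfl fun θ _ => mul_assoc _ _ _
    constructor
    · intro h
      have := sum_mul_pos (ν := ν⁻¹) (x := ν * (μ * fun θ => P.entry θ s)) hν'
        (fun θ => mul_nonneg (hν θ).le (hnn s θ)) (h1 ▸ h)
      have h2 : ν⁻¹ * (ν * (μ * fun θ => P.entry θ s)) = μ * fun θ => P.entry θ s := by
        ext θ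
        simp [(hν θ).ne']
      rwa [h2] at this
    · intro h
      rw [h1]
      exact sum_mul_pos hν (hnn s) h
  simp only [hprob]
  refine and_congr_right fun hpos => ?_
  have hmem : ∀ s, P.posterior μ s ∈ stdSimplex ℝ Θ := fun s => by
    rw [P.posterior_eq]
    exact toBelief_mem_stdSimplex (hnn s) (hpos s)
  have hpost : ∀ s, P.posterior (ν * μ) s = toBelief (ν * P.posterior μ s) := fun s => by
    rw [P.posterior_eq, P.posterior_eq, toBelief_mul_toBelief _ (hpos s)]
  refine and_congr (forall_congr' fun s => by rw [hpost, hext _ (hmem s)]) ?_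
  have hcover : ∀ (κ : Θ → ℝ) (X : Set (Θ → ℝ)),
      (⋃ s, {P.posterior κ s}) = X ↔
        (∀ s, P.posterior κ s ∈ X) ∧ ∀ x ∈ X, ∃ s, x = P.posterior κ s := fun κ X => by
    rw [Set.Subset.antisymm_iff, Set.iUnion_subset_iff]
    simp [Set.subset_def, eq_comm]
  rw [hcover, hcover]
  refine and_congr (forall_congr' fun s => by rw [hpost, hext _ (hmem s)]) ?_
  constructor
  · intro h y hy
    have hyΔ := hL hy.1
    have he := toBelief_mul_toBelief_inv hν hyΔ
    obtain ⟨s, hs⟩ := h (toBelief (ν⁻¹ * y))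
      ((hext _ (toBelief_mul_mem hν' hyΔ)).1 (by rwa [he]))
    exact ⟨s, by rw [hpost, ← hs, he]⟩
  · intro h x hx
    have hxΔ := hK hx.1
    obtain ⟨s, hs⟩ := h _ ((hext x hxΔ).2 hx)
    refine ⟨s, ?_⟩
    rw [← toBelief_inv_mul_toBelief hν hxΔ, hs, hpost,
      toBelief_inv_mul_toBelief hν (hmem s)]

theorem DecisionProblem.spectralSubdivision_scale (D : DecisionProblem.{u, v} Θ) {ν μ : Θ → ℝ}
    (hν : ∀ θ, 0 < ν θ) (hμ : ∀ θ, 0 < μ θ) :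
    (D.scale ν hν).spectralSubdivision μ = D.spectralSubdivision (ν * μ) := by
  ext E
  refine exists_congr fun a => and_congr (isUndominated_mul_iff hν D.util a) ?_
  rw [spectralElement_congr hν hμ (fun x hx => hx.1) (fun x hx => hx.1) (L := D.cell a)]
  intro x hx
  simp only [DecisionProblem.cell, Set.mem_ofPred_eq, toBelief_mul_mem hν hx, hx, true_and,
    value_scale]
  have hs := inv_pos.2 (sum_mul_pos_of_mem hν hx)
  rw [toBelief, expUtil_smul, D.value_smul hs.le, mul_right_inj' hs.ne', ← expUtil_mul_right]
  rfl

end Scale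

/-! ### Cells as polytopes, and rigidity of the subdivision. -/

section Cells

variable {Θ : Type u} [Fintype Θ]

namespace DecisionProblem

variable (D : DecisionProblem.{u, v} Θ)

/-- Homogeneity carries optimality over from beliefs; at the zero vector all actions tie. This is
needed because columns of experiments are unnormalized and may vanish. -/
theorem exists_optimal_of_nonneg [Nonempty Θ] {y : Θ → ℝ} (hy : ∀ θ, 0 ≤ y θ) :
    ∃ a, IsUndominated D.util a ∧ ∀ b, expUtil y (D.util b) ≤ expUtil y (D.util a) := by
  classical
  rcases (Finset.sum_nonneg fun θ (_ : θ ∈ Finset.univ) => hy θ).eq_or_lt with h | h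
  · have h0 := (Finset.sum_eq_zero_iff_of_nonneg fun θ _ => hy θ).1 h.symm
    obtain ⟨a, ha, -⟩ := D.exists_optimal _ (single_mem_stdSimplex ℝ (Classical.arbitrary Θ))
    exact ⟨a, ha, fun b => by simp [expUtil, fun θ => h0 θ (Finset.mem_univ θ)]⟩
  · obtain ⟨a, ha, hb⟩ := D.exists_optimal _ (toBelief_mem_stdSimplex hy h)
    exact ⟨a, ha, fun b => (expUtil_le_toBelief_iff h _ _).1 (hb b)⟩

theorem value_eq_of_optimal {y : Θ → ℝ} {a : D.Action}
    (h : ∀ b, expUtil y (D.util b) ≤ expUtil y (D.util a)) :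
    D.value y = expUtil y (D.util a) :=
  have := D.nonempty
  le_antisymm (ciSup_le h)
    (le_ciSup (f := fun b => expUtil y (D.util b)) ⟨_, Set.forall_mem_range.2 h⟩ a)

theorem expUtil_le_value [Nonempty Θ] {y : Θ → ℝ} (hy : ∀ θ, 0 ≤ y θ) (a : D.Action) :
    expUtil y (D.util a) ≤ D.value y := by
  obtain ⟨b, -, hb⟩ := D.exists_optimal_of_nonneg hy
  rw [D.value_eq_of_optimal hb]
  exact hb a

theorem mem_cell_iff {x : Θ → ℝ} {a : D.Action} :
    x ∈ D.cell a ↔ x ∈ stdSimplex ℝ Θ ∧ ∀ b, expUtil x (D.util b) ≤ expUtil x (D.util a) := by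
  refine and_congr_right fun hx => ⟨fun h b => ?_, fun h => (D.value_eq_of_optimal h).symm⟩
  obtain ⟨c, -, hc⟩ := D.exists_optimal x hx
  rw [h, D.value_eq_of_optimal hc]
  exact hc b

theorem mem_cell_iff_undominated {x : Θ → ℝ} {a : D.Action} :
    x ∈ D.cell a ↔ x ∈ stdSimplex ℝ Θ ∧
      ∀ b, IsUndominated D.util b → expUtil x (D.util b) ≤ expUtil x (D.util a) := by
  rw [mem_cell_iff]
  refine and_congr_right fun hx => ⟨fun h b _ => h b, fun h b => ?_⟩
  obtain ⟨c, hc, hcb⟩ := D.exists_optimal x hx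
  exact (hcb b).trans (h c hc)

theorem exists_mem_cell {x : Θ → ℝ} (hx : x ∈ stdSimplex ℝ Θ) :
    ∃ a, IsUndominated D.util a ∧ x ∈ D.cell a := by
  obtain ⟨a, ha, h⟩ := D.exists_optimal x hx
  exact ⟨a, ha, D.mem_cell_iff.2 ⟨hx, h⟩⟩

theorem isClosed_cell (a : D.Action) : IsClosed (D.cell a) := by
  have : D.cell a = stdSimplex ℝ Θ ∩
      ⋂ b, {x | expUtil x (D.util b) ≤ expUtil x (D.util a)} := by
    ext x
    simp [mem_cell_iff]
  rw [this]
  exact (isClosed_stdSimplex ℝ Θ).inter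
    (isClosed_iInter fun b => isClosed_le (by fun_prop) (by fun_prop))

theorem isCompact_cell (a : D.Action) : IsCompact (D.cell a) :=
  (isCompact_stdSimplex ℝ Θ).of_isClosed_subset (D.isClosed_cell a) fun _ hx => hx.1

theorem convex_cell (a : D.Action) : Convex ℝ (D.cell a) := by
  intro x hx y hy s t hs ht hst
  rw [mem_cell_iff] at hx hy ⊢
  refine ⟨convex_stdSimplex ℝ Θ hx.1 hy.1 hs ht hst, fun b => ?_⟩
  simp only [expUtil_add, expUtil_smul]
  exact add_le_add (mul_le_mul_of_nonneg_left (hx.2 b) hs)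
    (mul_le_mul_of_nonneg_left (hy.2 b) ht)

theorem finite_extremePoints_cell (a : D.Action) : (extremePoints ℝ (D.cell a)).Finite := by
  have : Finite {b // IsUndominated D.util b} := D.finite_undominated
  -- Comparing with undominated actions is enough, which keeps the list of constraints finite even
  -- if there are infinitely many actions.
  let g : Θ ⊕ {b // IsUndominated D.util b} → (Θ → ℝ) →ₗ[ℝ] ℝ :=
    Sum.elim LinearMap.proj fun b => expUtilLinear (D.util a) - expUtilLinear (D.util b)
  have h : D.cell a = {x | expUtilLinear 1 x = 1 ∧ ∀ i, 0 ≤ g i x} := by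
    ext x
    simp [mem_cell_iff_undominated, stdSimplex, expUtilLinear, expUtil, g]
    tauto
  rw [h]
  exact finite_extremePoints_of_linear_inequalities _ _ _

/-- The vertices of a cell. -/
noncomputable def cellVertices (a : D.Action) : Finset (Θ → ℝ) :=
  (D.finite_extremePoints_cell a).toFinset

theorem coe_cellVertices (a : D.Action) :
    (D.cellVertices a : Set (Θ → ℝ)) = extremePoints ℝ (D.cell a) :=
  (D.finite_extremePoints_cell a).coe_toFinset

/-- Krein–Milman; the hull of finitely many points is already closed, so no closure remains. -/
theorem convexHull_cellVertices (a : D.Action) :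
    convexHull ℝ (D.cellVertices a : Set (Θ → ℝ)) = D.cell a := by
  rw [← closure_convexHull_extremePoints (D.isCompact_cell a) (D.convex_cell a),
    coe_cellVertices]
  exact ((D.finite_extremePoints_cell a).isCompact_convexHull ℝ).isClosed.closure_eq.symm

theorem cellVertices_subset_cell (a : D.Action) :
    (D.cellVertices a : Set (Θ → ℝ)) ⊆ D.cell a :=
  (subset_convexHull ℝ _).trans (D.convexHull_cellVertices a).subset

theorem cell_subset_of_vertices_subset {D' : DecisionProblem.{u, v} Θ} {a : D.Action}
    {b : D'.Action} (h : (D.cellVertices a : Set (Θ → ℝ)) ⊆ D'.cell b) :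
    D.cell a ⊆ D'.cell b :=
  (D.convexHull_cellVertices a).symm.subset.trans (convexHull_min h (D'.convex_cell b))

theorem eq_of_mem_cell {x : Θ → ℝ} {a b : D.Action}
    (hx : ∀ c, c ≠ a → expUtil x (D.util c) < expUtil x (D.util a)) (h : x ∈ D.cell b) :
    b = a := by
  by_contra hne
  exact absurd ((D.mem_cell_iff.1 h).2 a) (not_le.2 (hx b hne))

theorem mem_cell_of_strict {x : Θ → ℝ} {a : D.Action} (hx : x ∈ stdSimplex ℝ Θ)
    (h : ∀ c, c ≠ a → expUtil x (D.util c) < expUtil x (D.util a)) : x ∈ D.cell a := by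
  refine D.mem_cell_iff.2 ⟨hx, fun b => ?_⟩
  by_cases hb : b = a
  · rw [hb]
  · exact (h b hb).le

/-- A belief at which `a` is strictly optimal lies in no other cell. -/
theorem eq_of_cell_subset {a b : D.Action} (ha : IsUndominated D.util a)
    (h : D.cell a ⊆ D.cell b) : b = a := by
  obtain ⟨x, hx, hs⟩ := ha
  exact D.eq_of_mem_cell hs (h (D.mem_cell_of_strict hx hs))

/-- A family of beliefs lies in one cell. -/
def CommonCell (X : Set (Θ → ℝ)) : Prop :=
  ∃ a, IsUndominated D.util a ∧ X ⊆ D.cell a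

/-- If each cell of `D` lies in a cell of `D'` and no two cells of `D` lie in the same cell of `D'`,
then `D` and `D'` have the same cells. -/
theorem spectralSubdivision_eq_of_commonCell {D D' : DecisionProblem.{u, v} Θ} (μ : Θ → ℝ)
    (h1 : ∀ a, IsUndominated D.util a → D'.CommonCell (D.cellVertices a))
    (h2 : ∀ a b, IsUndominated D.util a → IsUndominated D.util b → a ≠ b →
      ¬ D'.CommonCell (D.cellVertices a ∪ D.cellVertices b)) :
    D'.spectralSubdivision μ = D.spectralSubdivision μ := by
  have := D'.nonempty
  choose! g hg hsub using h1
  have hinj : ∀ a b, IsUndominated D.util a → IsUndominated D.util b → g a = g b → a = b := by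
    intro a b ha hb hab
    by_contra hne
    exact h2 a b ha hb hne ⟨g a, hg a ha, Set.union_subset (hsub a ha) (hab ▸ hsub b hb)⟩
  have hcell : ∀ a, IsUndominated D.util a → D.cell a ⊆ D'.cell (g a) := fun a ha =>
    D.cell_subset_of_vertices_subset (hsub a ha)
  have heq : ∀ a, IsUndominated D.util a → D'.cell (g a) = D.cell a := by
    intro a ha
    refine Set.Subset.antisymm (fun x hx => ?_) (hcell a ha)
    obtain ⟨y, hy, hys⟩ := hg a ha
    -- Mixing any positive weight of `y` into `x` makes `g a` strictly optimal for `D'`. Some cell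
    -- of `D` contains the mixture, and by injectivity of `g` it can only be that of `a`. Closedness
    -- then gives `x` itself as `t` tends to zero.
    have hmem : ∀ t ∈ Set.Ioc (0 : ℝ) 1, (1 - t) • x + t • y ∈ D.cell a := by
      rintro t ⟨ht0, ht1⟩
      have hz := convex_stdSimplex ℝ Θ hx.1 hy (sub_nonneg.2 ht1) ht0.le (sub_add_cancel 1 t)
      obtain ⟨b, hb, hzb⟩ := D.exists_mem_cell hz
      have hstrict : ∀ c, c ≠ g a → expUtil ((1 - t) • x + t • y) (D'.util c) <
          expUtil ((1 - t) • x + t • y) (D'.util (g a)) := fun c hc => by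
        simp only [expUtil_add, expUtil_smul]
        exact add_lt_add_of_le_of_lt
          (mul_le_mul_of_nonneg_left ((D'.mem_cell_iff.1 hx).2 c) (sub_nonneg.2 ht1))
          (mul_lt_mul_of_pos_left (hys c hc) ht0)
      rwa [hinj b a hb ha (D'.eq_of_mem_cell hstrict (hcell b hb hzb))] at hzb
    have hlim : Tendsto (fun t : ℝ => (1 - t) • x + t • y) (𝓝[>] 0) (𝓝 x) := by
      have : Tendsto (fun t : ℝ => (1 - t) • x + t • y) (𝓝 0)
          (𝓝 ((1 - (0 : ℝ)) • x + (0 : ℝ) • y)) := Continuous.tendsto (by fun_prop) 0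
      simp only [sub_zero, one_smul, zero_smul, add_zero] at this
      exact this.mono_left nhdsWithin_le_nhds
    exact (D.isClosed_cell a).mem_of_tendsto hlim
      (Filter.mem_of_superset (Ioc_mem_nhdsGT one_pos) hmem)
  have hsurj : ∀ a', IsUndominated D'.util a' → ∃ a, IsUndominated D.util a ∧ g a = a' := by
    rintro a' ⟨x, hx, hs⟩
    obtain ⟨a, ha, hxa⟩ := D.exists_mem_cell hx
    exact ⟨a, ha, D'.eq_of_mem_cell hs (hcell a ha hxa)⟩
  ext E
  constructor
  · rintro ⟨a', ha', rfl⟩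
    obtain ⟨a, ha, rfl⟩ := hsurj a' ha'
    exact ⟨a, ha, by rw [heq a ha]⟩
  · rintro ⟨a, ha, rfl⟩
    exact ⟨g a, hg a ha, by rw [heq a ha]⟩

end DecisionProblem

end Cells

/-! ### Splitting versus pooling signals. -/

section Experiments

variable {Θ : Type u}

/-- The experiment with given columns and one further column that makes up for the missing
probability. -/
noncomputable def SignalMatrix.withResidual {k : ℕ} (f : Fin k → Θ → ℝ) : SignalMatrix Θ where
  size := k + 1
  entry θ := Fin.cons (1 - ∑ i, f i θ) fun i => f i θ

theorem SignalMatrix.isExperiment_withResidual {k : ℕ} {f : Fin k → Θ → ℝ}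
    (h0 : ∀ i θ, 0 ≤ f i θ) (h1 : ∀ θ, ∑ i, f i θ ≤ 1) :
    (SignalMatrix.withResidual f).IsExperiment := by
  refine ⟨fun θ s => ?_, fun θ => ?_⟩
  · refine Fin.cases ?_ (fun i => ?_) s
    · simpa [withResidual] using h1 θ
    · simpa [withResidual] using h0 i θ
  · exact (Fin.sum_univ_succ _).trans (by simp [withResidual])

variable [Fintype Θ]

theorem DecisionProblem.experimentValue_withResidual (D : DecisionProblem.{u, v} Θ) {k : ℕ}
    {f : Fin k → Θ → ℝ} (h0 : ∀ i θ, 0 ≤ f i θ) (h1 : ∀ θ, ∑ i, f i θ ≤ 1) :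
    D.experimentValue 1 (SignalMatrix.withResidual f) =
      D.value (1 - ∑ i, f i) + ∑ i, D.value (f i) := by
  rw [D.experimentValue_eq (by simp) (SignalMatrix.isExperiment_withResidual h0 h1)]
  refine (Fin.sum_univ_succ _).trans ?_
  simp only [one_mul, SignalMatrix.withResidual, Fin.cons_zero, Fin.cons_succ]
  congr 2
  ext θ
  simp

theorem DecisionProblem.value_sum_le [Nonempty Θ] (D : DecisionProblem.{u, v} Θ) {ι : Type*}
    [Fintype ι] {f : ι → Θ → ℝ} (h0 : ∀ i θ, 0 ≤ f i θ) :
    D.value (∑ i, f i) ≤ ∑ i, D.value (f i) := by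
  obtain ⟨a, -, h⟩ := D.exists_optimal_of_nonneg (y := ∑ i, f i) fun θ => by
    rw [Finset.sum_apply]
    exact Finset.sum_nonneg fun i _ => h0 i θ
  rw [D.value_eq_of_optimal h, expUtil_sum]
  exact Finset.sum_le_sum fun i _ => D.expUtil_le_value (h0 i) a

/-- Pooling signals does not lower the value iff one action is optimal after all of them. -/
theorem DecisionProblem.value_sum_eq_iff [Nonempty Θ] (D : DecisionProblem.{u, v} Θ)
    {ι : Type*} [Fintype ι] {f : ι → Θ → ℝ} (h0 : ∀ i θ, 0 ≤ f i θ) :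
    ∑ i, D.value (f i) = D.value (∑ i, f i) ↔
      ∃ a, IsUndominated D.util a ∧ ∀ i, expUtil (f i) (D.util a) = D.value (f i) := by
  have hs : ∀ θ, 0 ≤ (∑ i, f i) θ := fun θ => by
    rw [Finset.sum_apply]
    exact Finset.sum_nonneg fun i _ => h0 i θ
  constructor
  · intro h
    -- An action optimal for the pooled signal is at most as good as `V` at each part, so equality
    -- of the sums forces equality term by term.
    obtain ⟨a, ha, hopt⟩ := D.exists_optimal_of_nonneg hs
    rw [D.value_eq_of_optimal hopt, expUtil_sum, eq_comm,
      Finset.sum_eq_sum_iff_of_le fun i _ => D.expUtil_le_value (h0 i) a] at h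
    exact ⟨a, ha, fun i => h i (Finset.mem_univ i)⟩
  · rintro ⟨a, -, h⟩
    refine le_antisymm ?_ (D.value_sum_le h0)
    rw [← Finset.sum_congr rfl fun i _ => h i, ← expUtil_sum]
    exact D.expUtil_le_value hs a

/-- The beliefs in `X`, in some order, scaled so that their sum is at most one. -/
noncomputable def scaledColumns (X : Finset (Θ → ℝ)) (i : Fin X.card) : Θ → ℝ :=
  -- The added one keeps the factor positive even if `X` is empty.
  ((X.card : ℝ) + 1)⁻¹ • (X.equivFin.symm i : Θ → ℝ)

/-- The experiment that, apart from a residual signal, leads to the beliefs in `X` under the uniform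
prior. -/
noncomputable def splitExperiment (X : Finset (Θ → ℝ)) : SignalMatrix Θ :=
  SignalMatrix.withResidual (scaledColumns X)

/-- The experiment that pools all nonresidual signals of `splitExperiment X`. -/
noncomputable def pooledExperiment (X : Finset (Θ → ℝ)) : SignalMatrix Θ :=
  SignalMatrix.withResidual fun _ : Fin 1 => ∑ i, scaledColumns X i

variable {X : Finset (Θ → ℝ)}

theorem scaledColumns_nonneg (hX : (X : Set (Θ → ℝ)) ⊆ stdSimplex ℝ Θ) (i : Fin X.card)
    (θ : Θ) : 0 ≤ scaledColumns X i θ :=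
  mul_nonneg (by positivity) ((hX (X.equivFin.symm i).2).1 θ)

theorem sum_scaledColumns_le (hX : (X : Set (Θ → ℝ)) ⊆ stdSimplex ℝ Θ) (θ : Θ) :
    ∑ i, scaledColumns X i θ ≤ 1 := by
  have h : ∀ i, scaledColumns X i θ ≤ ((X.card : ℝ) + 1)⁻¹ := fun i => by
    have hm := hX (X.equivFin.symm i).2
    have : (X.equivFin.symm i : Θ → ℝ) θ ≤ 1 :=
      hm.2 ▸ Finset.single_le_sum (fun θ _ => hm.1 θ) (Finset.mem_univ θ)
    exact mul_le_of_le_one_right (by positivity) this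
  calc ∑ i, scaledColumns X i θ ≤ ∑ _i : Fin X.card, ((X.card : ℝ) + 1)⁻¹ :=
        Finset.sum_le_sum fun i _ => h i
    _ = X.card / ((X.card : ℝ) + 1) := by simp [div_eq_mul_inv]
    _ ≤ 1 := by
        rw [div_le_one (by positivity)]
        linarith

theorem isExperiment_splitExperiment (hX : (X : Set (Θ → ℝ)) ⊆ stdSimplex ℝ Θ) :
    (splitExperiment X).IsExperiment :=
  SignalMatrix.isExperiment_withResidual (scaledColumns_nonneg hX) (sum_scaledColumns_le hX)

theorem pooledColumn_nonneg (hX : (X : Set (Θ → ℝ)) ⊆ stdSimplex ℝ Θ) (_ : Fin 1) (θ : Θ) :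
    0 ≤ (∑ i, scaledColumns X i) θ := by
  rw [Finset.sum_apply]
  exact Finset.sum_nonneg fun i _ => scaledColumns_nonneg hX i θ

theorem sum_pooledColumn_le (hX : (X : Set (Θ → ℝ)) ⊆ stdSimplex ℝ Θ) (θ : Θ) :
    ∑ _j : Fin 1, (∑ i, scaledColumns X i) θ ≤ 1 := by
  simpa using sum_scaledColumns_le hX θ

theorem isExperiment_pooledExperiment (hX : (X : Set (Θ → ℝ)) ⊆ stdSimplex ℝ Θ) :
    (pooledExperiment X).IsExperiment :=
  SignalMatrix.isExperiment_withResidual (pooledColumn_nonneg hX) (sum_pooledColumn_le hX)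

namespace DecisionProblem

variable (D : DecisionProblem.{u, v} Θ)

theorem experimentValue_split (hX : (X : Set (Θ → ℝ)) ⊆ stdSimplex ℝ Θ) :
    D.experimentValue 1 (splitExperiment X) =
      D.value (1 - ∑ i, scaledColumns X i) + ∑ i, D.value (scaledColumns X i) :=
  D.experimentValue_withResidual (scaledColumns_nonneg hX) (sum_scaledColumns_le hX)

theorem experimentValue_pooled (hX : (X : Set (Θ → ℝ)) ⊆ stdSimplex ℝ Θ) :
    D.experimentValue 1 (pooledExperiment X) =
      D.value (1 - ∑ i, scaledColumns X i) + D.value (∑ i, scaledColumns X i) := by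
  simpa [pooledExperiment] using
    D.experimentValue_withResidual (pooledColumn_nonneg hX) (sum_pooledColumn_le hX)

theorem commonCell_iff (hX : (X : Set (Θ → ℝ)) ⊆ stdSimplex ℝ Θ) :
    D.CommonCell X ↔ ∃ a, IsUndominated D.util a ∧
      ∀ i, expUtil (scaledColumns X i) (D.util a) = D.value (scaledColumns X i) := by
  refine exists_congr fun a => and_congr_right fun _ => ?_
  have hc : (0 : ℝ) < ((X.card : ℝ) + 1)⁻¹ := by positivity
  simp only [scaledColumns, expUtil_smul, D.value_smul hc.le, mul_right_inj' hc.ne']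
  constructor
  · exact fun h i => (h (X.equivFin.symm i).2).2
  · refine fun h x hx => ⟨hX hx, ?_⟩
    simpa using h (X.equivFin ⟨x, hx⟩)

/-- The residual signal is common to both experiments and cancels, leaving the equality case of
subadditivity. -/
theorem experimentValue_split_eq_pooled_iff [Nonempty Θ]
    (hX : (X : Set (Θ → ℝ)) ⊆ stdSimplex ℝ Θ) :
    D.experimentValue 1 (splitExperiment X) = D.experimentValue 1 (pooledExperiment X) ↔
      D.CommonCell X := by
  rw [D.experimentValue_split hX, D.experimentValue_pooled hX, add_right_inj,
    D.value_sum_eq_iff (scaledColumns_nonneg hX), D.commonCell_iff hX]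

theorem experimentValue_pooled_lt_split_iff [Nonempty Θ]
    (hX : (X : Set (Θ → ℝ)) ⊆ stdSimplex ℝ Θ) :
    D.experimentValue 1 (pooledExperiment X) < D.experimentValue 1 (splitExperiment X) ↔
      ¬ D.CommonCell X := by
  have hle : D.experimentValue 1 (pooledExperiment X) ≤
      D.experimentValue 1 (splitExperiment X) := by
    rw [D.experimentValue_split hX, D.experimentValue_pooled hX]
    exact add_le_add_right (D.value_sum_le (scaledColumns_nonneg hX)) _
  rw [← D.experimentValue_split_eq_pooled_iff hX, lt_iff_le_and_ne, and_iff_right hle, ne_comm]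

end DecisionProblem

/-! ### Assembling the identifying collection. -/

/-- A collection of ranked experiments indexed by an arbitrary finite type. -/
noncomputable def RankedExperiments.ofFintype {ι : Type*} [Fintype ι] (expt : ι → SignalMatrix Θ)
    (h : ∀ i, (expt i).IsExperiment) (strict indiff : Set (ι × ι)) : RankedExperiments Θ where
  num := Fintype.card ι
  expt i := expt ((Fintype.equivFin ι).symm i)
  isExperiment _ := h _
  strict := {p | ((Fintype.equivFin ι).symm p.1, (Fintype.equivFin ι).symm p.2) ∈ strict}
  indiff := {p | ((Fintype.equivFin ι).symm p.1, (Fintype.equivFin ι).symm p.2) ∈ indiff}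

theorem RankedExperiments.satisfiedBy_ofFintype {ι : Type*} [Fintype ι]
    (expt : ι → SignalMatrix Θ) (h : ∀ i, (expt i).IsExperiment) (strict indiff : Set (ι × ι))
    (D : DecisionProblem.{u, v} Θ) (μ : Θ → ℝ) :
    (RankedExperiments.ofFintype expt h strict indiff).SatisfiedBy D μ ↔
      (∀ i j, (i, j) ∈ strict →
        D.experimentValue μ (expt j) < D.experimentValue μ (expt i)) ∧
      (∀ i j, (i, j) ∈ indiff →
        D.experimentValue μ (expt i) = D.experimentValue μ (expt j)) := by
  have key : ∀ (T : Set (ι × ι)) (r : ι → ι → Prop),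
      (∀ k l : Fin (Fintype.card ι),
        ((Fintype.equivFin ι).symm k, (Fintype.equivFin ι).symm l) ∈ T →
          r ((Fintype.equivFin ι).symm k) ((Fintype.equivFin ι).symm l)) ↔
      ∀ i j, (i, j) ∈ T → r i j := fun T r =>
    ⟨fun H i j => by simpa using H (Fintype.equivFin ι i) (Fintype.equivFin ι j),
      fun H k l => H _ _⟩
  exact and_congr
    (key strict fun i j => D.experimentValue μ (expt j) < D.experimentValue μ (expt i))
    (key indiff fun i j => D.experimentValue μ (expt i) = D.experimentValue μ (expt j))

theorem RankedExperiments.satisfiedBy_scale (R : RankedExperiments Θ)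
    (D : DecisionProblem.{u, v} Θ) {ν μ : Θ → ℝ} (hν : ∀ θ, 0 < ν θ) (hμ : ∀ θ, 0 < μ θ) :
    R.SatisfiedBy (D.scale ν hν) μ ↔ R.SatisfiedBy D (ν * μ) := by
  simp only [SatisfiedBy, fun i => D.experimentValue_scale hν hμ (R.isExperiment i)]

/-- Finitely many rankings pin down the subdivision of a decision problem under the (untoBeliefd)
uniform prior. -/
theorem DecisionProblem.exists_rankedExperiments [Nonempty Θ] (D : DecisionProblem.{u, v} Θ) :
    ∃ R : RankedExperiments Θ, R.SatisfiedBy D 1 ∧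
      ∀ D' : DecisionProblem.{u, v} Θ, R.SatisfiedBy D' 1 →
        D'.spectralSubdivision 1 = D.spectralSubdivision 1 := by
  classical
  let U := {a // IsUndominated D.util a}
  have : Finite U := D.finite_undominated
  have : Fintype U := Fintype.ofFinite U
  let X : U × U → Finset (Θ → ℝ) := fun p => D.cellVertices p.1 ∪ D.cellVertices p.2
  have hX : ∀ p, (X p : Set (Θ → ℝ)) ⊆ stdSimplex ℝ Θ := fun p => by
    rw [Finset.coe_union]
    exact Set.union_subset (fun x hx => (D.cellVertices_subset_cell _ hx).1)
      fun x hx => (D.cellVertices_subset_cell _ hx).1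
  let expt : (U × U) ⊕ (U × U) → SignalMatrix Θ :=
    Sum.elim (fun p => splitExperiment (X p)) fun p => pooledExperiment (X p)
  have hexpt : ∀ i, (expt i).IsExperiment := by
    rintro (p | p)
    · exact isExperiment_splitExperiment (hX p)
    · exact isExperiment_pooledExperiment (hX p)
  -- Diagonal pairs, where `X p` is the vertex set of a single cell, give the indifferences;
  -- off-diagonal pairs give the strict rankings.
  let R := RankedExperiments.ofFintype expt hexpt
    {q | ∃ p : U × U, p.1 ≠ p.2 ∧ q = (Sum.inl p, Sum.inr p)}
    {q | ∃ p : U × U, p.1 = p.2 ∧ q = (Sum.inl p, Sum.inr p)}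
  have hR : ∀ D' : DecisionProblem.{u, v} Θ, R.SatisfiedBy D' 1 ↔
      (∀ p : U × U, p.1 ≠ p.2 → ¬ D'.CommonCell (X p)) ∧
      (∀ p : U × U, p.1 = p.2 → D'.CommonCell (X p)) := by
    intro D'
    rw [RankedExperiments.satisfiedBy_ofFintype]
    refine and_congr ⟨fun h p hp => ?_, ?_⟩ ⟨fun h p hp => ?_, ?_⟩
    · exact (D'.experimentValue_pooled_lt_split_iff (hX p)).1 (h _ _ ⟨p, hp, rfl⟩)
    · rintro h i j ⟨p, hp, hij⟩
      obtain ⟨rfl, rfl⟩ := Prod.mk.inj hij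
      exact (D'.experimentValue_pooled_lt_split_iff (hX p)).2 (h p hp)
    · exact (D'.experimentValue_split_eq_pooled_iff (hX p)).1 (h _ _ ⟨p, hp, rfl⟩)
    · rintro h i j ⟨p, hp, hij⟩
      obtain ⟨rfl, rfl⟩ := Prod.mk.inj hij
      exact (D'.experimentValue_split_eq_pooled_iff (hX p)).2 (h p hp)
  refine ⟨R, (hR D).2 ⟨?_, ?_⟩, fun D' hD' => ?_⟩
  · rintro ⟨a, b⟩ hab ⟨c, -, hsub⟩
    rw [Finset.coe_union, Set.union_subset_iff] at hsub
    have h1 := D.eq_of_cell_subset a.2 (D.cell_subset_of_vertices_subset hsub.1)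
    have h2 := D.eq_of_cell_subset b.2 (D.cell_subset_of_vertices_subset hsub.2)
    exact hab (Subtype.ext (h1.symm.trans h2))
  · rintro ⟨a, b⟩ hab
    obtain rfl : a = b := hab
    refine ⟨a, a.2, ?_⟩
    simpa [X] using D.cellVertices_subset_cell a
  · obtain ⟨h1, h2⟩ := (hR D').1 hD'
    refine spectralSubdivision_eq_of_commonCell 1 (fun a ha => ?_) fun a b ha hb hab => ?_
    · simpa [X] using h2 (⟨a, ha⟩, ⟨a, ha⟩) rfl
    · simpa [X] using h1 (⟨a, ha⟩, ⟨b, hb⟩) fun h => hab (congrArg Subtype.val h)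

end Experiments

theorem corollary2 {Θ : Type u} [Fintype Θ] (hΘ : 2 ≤ Fintype.card Θ)
    (C : Set (Set (SignalMatrix Θ))) (hC : IsSpectralSubdivision.{u, v} C) :
    ∃ R : RankedExperiments Θ, RankedExperiments.Identifies.{u, v} R C := by
  have : Nonempty Θ := Fintype.card_pos_iff.1 (by omega)
  obtain ⟨D, ν, ⟨-, hν⟩, rfl⟩ := hC
  have h1 : ∀ θ : Θ, (0 : ℝ) < (1 : Θ → ℝ) θ := fun _ => one_pos
  -- The prior `ν` is absorbed into the payoffs. The weight vector `1` is not a probability vector,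
  -- which is harmless by homogeneity.
  obtain ⟨R, hR, hRD⟩ := (D.scale ν hν).exists_rankedExperiments
  rw [R.satisfiedBy_scale D hν h1, mul_one] at hR
  rw [D.spectralSubdivision_scale hν h1, mul_one] at hRD
  refine ⟨R, fun μ hμ => ?_, fun D' μ hμ hD' => ?_⟩
  -- Scaling payoffs by `ν / μ` makes the prior-weighted payoffs at `μ` equal to those of `D` at
  -- `ν`.
  · have hpos : ∀ θ, 0 < (ν / μ) θ := fun θ => div_pos (hν θ) (hμ.2 θ)
    have hmul : ν / μ * μ = ν := by
      ext θ
      simp [(hμ.2 θ).ne']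
    refine ⟨D.scale (ν / μ) hpos, ?_, ?_⟩
    · rwa [R.satisfiedBy_scale D hpos hμ.2, hmul]
    · rw [D.spectralSubdivision_scale hpos hμ.2, hmul]
  · have h := hRD (D'.scale μ hμ.2)
    rw [R.satisfiedBy_scale D' hμ.2 h1, D'.spectralSubdivision_scale hμ.2 h1, mul_one] at h
    exact h hD'
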